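/- Let $G$ be an infinite amenable group, not isomorphic to $\mathbb Z$, generated by $p$ elements $s_1,\dots,s_p$. Consider words in the $2p$ formal letters $s_1^{\pm1},\dots,s_p^{\pm1}$. Let $d_n$ (the cogrowth function) be the number of words of length $n$ that are equal to the identity in $G$, and let $c_n$ (the reduced-cogrowth function) be the number of such words that are freely reduced. Then $D:=\limsup_{n\to\infty} d_n^{1/n}=2p$ and $C:=\limsup_{n\to\infty} c_n^{1/n}=2p-1$, and the sub-dominant terms $\tilde d_n=d_n/D^n$ and $\tilde c_n=c_n/C^n$, which remain after the dominant exponential factors are divided out, are asymptotically equivalent along even lengths: $$(\tilde d_{2k})_{k}\sim(\tilde c_{2k})_{k}.$$ If moreover some word of odd length is equal to the identity, then the full sequences are equivalent as well: $(\tilde d_n)_n\sim(\tilde c_n)_n$. (If there is no such word, all the odd terms of both sequences are zero.) Here, for real sequences $f,g$, one writes $f\precsim g$ if there are constants $a,b>0$ such that $f(n)\le a\,g(\lfloor bn\rfloor)$ for all large $n$, and $f\sim g$ if $f\precsim g$ and $g\precsim f$. -/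

import Mathlib

open Filter Topology

noncomputable section

namespace Cogrowth

/-- The boundary of a finite set `F` of group elements with respect to a set `T`: the elements
`g ∉ F` such that `g * s ∈ F` for some `s ∈ T`. -/
def boundary {G : Type*} [Group G] (T F : Finset G) : Set G :=
  {g | g ∉ F ∧ ∃ s ∈ T, g * s ∈ F}

/-- Amenability of a (discrete) group, by Følner's condition: for every finite set `T` there are
nonempty finite sets `F n` with `|∂ (F n)| / |F n| → 0`, the boundary being taken with respect
to `T`. -/
def IsAmenable (G : Type*) [Group G] : Prop :=
  ∀ T : Finset G, ∃ F : ℕ → Finset G, (∀ n, (F n).Nonempty) ∧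
    Tendsto (fun n => ((boundary T (F n)).ncard : ℝ) / ((F n).card : ℝ)) atTop (𝓝 0)

/-- The element of `G` represented by a word in the `2p` letters `s i` (written `(i, true)`) and
`(s i)⁻¹` (written `(i, false)`). -/
def wordEval {G : Type*} [Group G] {p : ℕ} (s : Fin p → G) (w : List (Fin p × Bool)) : G :=
  (w.map fun x => if x.2 then s x.1 else (s x.1)⁻¹).prod

/-- The cogrowth function `d n`: the number of words (reduced or not) of length `n` which are
equal to the identity. -/
def cogrowth {G : Type*} [Group G] {p : ℕ} (s : Fin p → G) (n : ℕ) : ℕ :=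
  Set.ncard {w : List (Fin p × Bool) | w.length = n ∧ wordEval s w = 1}

/-- The reduced-cogrowth function `c n`: the number of freely reduced words of length `n` which
are equal to the identity. -/
def reducedCogrowth {G : Type*} [Group G] {p : ℕ} (s : Fin p → G) (n : ℕ) : ℕ :=
  Set.ncard {w : List (Fin p × Bool) |
    w.length = n ∧ FreeGroup.IsReduced w ∧ wordEval s w = 1}

/-- The exponential growth rate `limsup (a n) ^ (1 / n)`. -/
def growthRate (a : ℕ → ℕ) : ℝ :=
  limsup (fun n : ℕ => (a n : ℝ) ^ (1 / (n : ℝ))) atTop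

/-- The sub-dominant factor of a sequence: what is left of `a n` after the dominant exponential
factor `(growthRate a) ^ n` is divided out. -/
def subdominant (a : ℕ → ℕ) (n : ℕ) : ℝ :=
  (a n : ℝ) / growthRate a ^ n

/-- `f ≾ g`: there are `a, b > 0` with `f n ≤ a * g (b * n)` for all large `n`
(`b * n` rounded down, since `g` is a sequence). -/
def AsympLE (f g : ℕ → ℝ) : Prop :=
  ∃ a b : ℝ, 0 < a ∧ 0 < b ∧ ∀ᶠ n : ℕ in atTop, f n ≤ a * g ⌊b * (n : ℝ)⌋₊

/-- `f ∼ g`: `f ≾ g` and `g ≾ f`. -/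
def AsympEquiv (f g : ℕ → ℝ) : Prop :=
  AsympLE f g ∧ AsympLE g f

end Cogrowth

end

/-! Both counts are moments of one spectral measure. Let `M` be the Markov operator on `ℓ²(G)`,
self-adjoint with norm at most 1, and put q = 2p - 1. Then d_n / (2p)^n = ⟨δ, M^n δ⟩, while a
three-term recurrence for reduced words gives c_n = ⟨δ, P_n(M) δ⟩ with P_n = `reducedPoly q n`. Any
polynomial inequality on [-1, 1] passes to these moments (`moment_mono`), so the comparison becomes
one between x^n and P_n(x).

If z ≥ w are the roots with z + w = (q + 1)x and zw = q, then P_n is a difference of complete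
homogeneous sums in z and w. For small |x| the roots are complex of modulus √q and P_n is
exponentially smaller than q^n. For larger x in [0, 1] they are real with w ≥ 1, and P_n has size
about z^n, where q x^(4p) ≤ z, and z ≤ qx. Hence, up to exponentially small errors, P_{2k}(x) /
q^(2k) is at most 2x^(2k) (`eval_reducedPoly_le`) and at least x^(2n) once n ≥ 4pk
(`pow_le_eval_reducedPoly_add`). The change of scale 4p is allowed by the relation ≾.

Amenability removes the errors: Følner sets are almost invariant vectors, so return probabilities
decay subexponentially (`exists_mul_pow_le_cogrowth`). This also gives both growth rates. For odd
lengths, appending a cyclically reduced odd relator or its inverse changes parity at the cost of a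
constant factor. -/

noncomputable section
namespace Cogrowth

open Filter Topology Polynomial
open scoped InnerProductSpace

/-- The Hilbert space `ℓ²(G)`. -/
abbrev EllTwo (G : Type*) := lp (fun _ : G => ℂ) 2

/-! ### The right regular representation -/

section Operators

variable {G : Type*}

theorem memlp_comp_equiv {ι : Type*} (e : ι ≃ ι) (f : lp (fun _ : ι => ℂ) 2) :
    Memℓp (fun i => f (e i)) 2 := by
  have h := lp.memℓp f
  rw [memℓp_gen_iff (by norm_num)] at h ⊢
  exact e.summable_iff.2 h

open Classical in
/-- The point mass at `g`. -/
def pointMass (g : G) : EllTwo G := lp.single 2 g 1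

theorem inner_pointMass (g : G) (f : EllTwo G) : ⟪pointMass g, f⟫_ℂ = f g := by
  classical
  simp [pointMass, lp.inner_single_left]

theorem pointMass_apply [DecidableEq G] (g h : G) :
    pointMass g h = if h = g then 1 else 0 := by
  classical
  simp [pointMass, lp.single_apply, Pi.single_apply]

variable [Group G]

/-- Right translation `(f · g)(h) = f (h g)` on `ℓ²(G)`. -/
def translate (g : G) : EllTwo G →ₗᵢ[ℂ] EllTwo G where
  toFun f := ⟨fun h => f (h * g), memlp_comp_equiv (Equiv.mulRight g) f⟩
  map_add' _ _ := rfl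
  map_smul' _ _ := rfl
  norm_map' f := by
    rw [lp.norm_eq_tsum_rpow (by norm_num), lp.norm_eq_tsum_rpow (by norm_num)]
    congr 1
    exact (Equiv.mulRight g).tsum_eq fun i => ‖f i‖ ^ ENNReal.toReal 2

theorem translate_apply (g h : G) (f : EllTwo G) : translate g f h = f (h * g) := rfl

/-- The right regular representation on `ℓ²(G)`. -/
def regularRep (G : Type*) [Group G] : G →* (EllTwo G →L[ℂ] EllTwo G) where
  toFun g := (translate g).toContinuousLinearMap
  map_one' := by
    ext f h
    simp [translate_apply]
  map_mul' g h := by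
    ext f k
    simp [translate_apply, mul_assoc]

theorem regularRep_apply (g h : G) (f : EllTwo G) : regularRep G g f h = f (h * g) := rfl

theorem norm_regularRep_le (g : G) : ‖regularRep G g‖ ≤ 1 :=
  (translate g).norm_toContinuousLinearMap_le

theorem inner_regularRep_pointMass [DecidableEq G] (x g h : G) :
    ⟪pointMass g, regularRep G x (pointMass h)⟫_ℂ = if g * x = h then 1 else 0 := by
  rw [inner_pointMass, regularRep_apply, pointMass_apply]

theorem adjoint_regularRep (g : G) : star (regularRep G g) = regularRep G g⁻¹ := by
  rw [ContinuousLinearMap.star_eq_adjoint]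
  symm
  rw [ContinuousLinearMap.eq_adjoint_iff]
  intro x y
  have h := (translate g).inner_map_map (regularRep G g⁻¹ x) y
  rw [← h]
  congr 1
  ext k
  simp [translate_apply, regularRep_apply]

end Operators

/-! ### Spectral positivity of moments -/

section Positivity

variable {H : Type*} [NormedAddCommGroup H] [InnerProductSpace ℂ H]

/-- The linear functional `f ↦ Re ⟨v, f(M) v⟩` on real polynomials. -/
def moment (M : H →L[ℂ] H) (v : H) : ℝ[X] →ₗ[ℝ] ℝ where
  toFun f := (⟪v, aeval M f v⟫_ℂ).re
  map_add' f g := by simp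
  map_smul' r f := by
    have : ((aeval M) (r • f)) v = (r : ℂ) • (aeval M f v) := by
      rw [map_smul]
      exact (Complex.coe_smul r ((aeval M) f v)).symm
    rw [this, inner_smul_right]
    simp

theorem moment_apply (M : H →L[ℂ] H) (v : H) (f : ℝ[X]) :
    moment M v f = (⟪v, aeval M f v⟫_ℂ).re := rfl

variable [CompleteSpace H]

/-- The spectrum of `M` lies in [-1, 1], so the functional calculus makes `f(M)` a positive
operator. -/
theorem moment_nonneg {M : H →L[ℂ] H} (hM : IsSelfAdjoint M) (hM1 : ‖M‖ ≤ 1) (v : H) (f : ℝ[X])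
    (hf : ∀ x : ℝ, |x| ≤ 1 → 0 ≤ f.eval x) : 0 ≤ moment M v f := by
  have h0 : 0 ≤ aeval M f := by
    rw [← cfc_polynomial f M hM]
    apply cfc_nonneg
    intro x hx
    apply hf
    have h1 := spectrum.norm_le_norm_mul_of_mem hx
    have h2 : ‖(1 : H →L[ℂ] H)‖ ≤ 1 := ContinuousLinearMap.norm_id_le
    rw [Real.norm_eq_abs] at h1
    calc |x| ≤ ‖M‖ * ‖(1 : H →L[ℂ] H)‖ := h1
      _ ≤ 1 * 1 := by gcongr
      _ = 1 := one_mul 1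
  rw [ContinuousLinearMap.nonneg_iff_isPositive] at h0
  exact h0.re_inner_nonneg_right v

theorem moment_mono {M : H →L[ℂ] H} (hM : IsSelfAdjoint M) (hM1 : ‖M‖ ≤ 1) (v : H) (f g : ℝ[X])
    (hf : ∀ x : ℝ, |x| ≤ 1 → f.eval x ≤ g.eval x) : moment M v f ≤ moment M v g := by
  have := moment_nonneg hM hM1 v (g - f) fun x hx => by simpa using hf x hx
  rw [map_sub] at this
  linarith

theorem moment_X_pow_two_mul {M : H →L[ℂ] H} (hM : IsSelfAdjoint M) (v : H) (k : ℕ) :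
    moment M v (X ^ (2 * k)) = ‖(M ^ k) v‖ ^ 2 := by
  rw [moment_apply, map_pow, aeval_X, two_mul, pow_add, mul_apply_eq_comp]
  have h : IsSelfAdjoint (M ^ k) := hM.pow k
  rw [← ContinuousLinearMap.adjoint_inner_left, ContinuousLinearMap.isSelfAdjoint_iff'.1 h,
    inner_self_eq_norm_sq_to_K]
  norm_cast

/-- Jensen's inequality for even moments. -/
theorem pow_mul_le_moment {M : H →L[ℂ] H} (hM : IsSelfAdjoint M) (hM1 : ‖M‖ ≤ 1) (v : H) (k : ℕ)
    (t : ℝ) (ht : 0 ≤ t) (h : t * moment M v 1 ≤ moment M v X) :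
    t ^ (2 * k) * moment M v 1 ≤ moment M v (X ^ (2 * k)) := by
  rcases Nat.eq_zero_or_pos k with rfl | hk
  · simp
  -- A convex function lies above its tangent at `t`; the slope is nonnegative, so a lower bound on
  -- the first moment suffices.
  have key : ∀ x : ℝ, t ^ (2 * k) + (2 * k : ℕ) * t ^ (2 * k - 1) * (x - t) ≤ x ^ (2 * k) := by
    intro x
    have hc : ConvexOn ℝ Set.univ fun y : ℝ => y ^ (2 * k) := Even.convexOn_pow (by simp)
    have hd : HasDerivAt (fun y : ℝ => y ^ (2 * k)) ((2 * k : ℕ) * t ^ (2 * k - 1)) t :=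
      hasDerivAt_pow (2 * k) t
    rcases lt_trichotomy x t with hx | hx | hx
    · have := hc.slope_le_of_hasDerivAt (Set.mem_univ x) (Set.mem_univ t) hx hd
      rw [slope_def_field, div_le_iff₀ (by linarith)] at this
      linarith
    · simp [hx]
    · have := hc.le_slope_of_hasDerivAt (Set.mem_univ t) (Set.mem_univ x) hx hd
      rw [slope_def_field, le_div_iff₀ (by linarith)] at this
      linarith
  set a : ℝ := (2 * k : ℕ) * t ^ (2 * k - 1) with ha
  have ha0 : 0 ≤ a := by positivity
  have := moment_mono hM hM1 v ((t ^ (2 * k) - a * t) • (1 : ℝ[X]) + a • X) (X ^ (2 * k))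
    fun x _ => by
      simp only [eval_add, eval_smul, eval_one, eval_X, eval_pow, smul_eq_mul]
      linarith [key x]
  simp only [map_add, map_smul, smul_eq_mul] at this
  nlinarith [mul_le_mul_of_nonneg_left h ha0]

end Positivity

/-! ### Sums over words and the recurrence for reduced words -/

section Words

variable {p : ℕ}

/-- The finite set of words of length `n`. -/
def words (p : ℕ) : ℕ → Finset (List (Fin p × Bool))
  | 0 => {[]}
  | n + 1 => (Finset.univ ×ˢ words p n).image fun x => x.1 :: x.2

theorem mem_words {n : ℕ} {w : List (Fin p × Bool)} : w ∈ words p n ↔ w.length = n := by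
  induction n generalizing w with
  | zero => simp [words]
  | succ n ih =>
    cases w with
    | nil => simp [words]
    | cons a w => simp [words, ih]

theorem sum_words_succ {R : Type*} [AddCommMonoid R] (n : ℕ) (f : List (Fin p × Bool) → R) :
    ∑ w ∈ words p (n + 1), f w = ∑ a, ∑ w ∈ words p n, f (a :: w) := by
  rw [words, Finset.sum_image, Finset.sum_product]
  rintro ⟨a, w⟩ _ ⟨b, v⟩ _ h
  simpa using h

theorem sum_words_prod {R : Type*} [Semiring R] (x : Fin p × Bool → R) (n : ℕ) :
    ∑ w ∈ words p n, (w.map x).prod = (∑ a, x a) ^ n := by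
  induction n with
  | zero => simp [words]
  | succ n ih =>
    rw [sum_words_succ, pow_succ', ← ih, Finset.sum_mul]
    simp [Finset.mul_sum]

/-- The inverse of a letter. -/
def flipLetter (a : Fin p × Bool) : Fin p × Bool := (a.1, !a.2)

theorem flipLetter_flipLetter (a : Fin p × Bool) : flipLetter (flipLetter a) = a := by
  simp [flipLetter]

theorem flipLetter_bijective : Function.Bijective (flipLetter (p := p)) :=
  Function.Involutive.bijective flipLetter_flipLetter

theorem isReduced_cons_cons_iff {a b : Fin p × Bool} {w : List (Fin p × Bool)} :
    FreeGroup.IsReduced (a :: b :: w) ↔ b ≠ flipLetter a ∧ FreeGroup.IsReduced (b :: w) := by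
  rw [FreeGroup.isReduced_cons_cons, and_comm, and_comm (a := b ≠ _)]
  refine and_congr_right fun _ => ?_
  obtain ⟨i, c⟩ := a
  obtain ⟨j, d⟩ := b
  simp only [flipLetter, ne_eq, Prod.mk.injEq, not_and]
  cases c <;> cases d <;> simp [eq_comm]

open Classical in
/-- The sum of the values of the reduced words `a :: w` with `w` of length `n`. -/
def reducedSumFrom {R : Type*} [Ring R] (x : Fin p × Bool → R) (n : ℕ) (a : Fin p × Bool) : R :=
  ∑ w ∈ words p n, if FreeGroup.IsReduced (a :: w) then ((a :: w).map x).prod else 0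

open Classical in
/-- The sum of the values of the reduced words of length `n`. -/
def reducedSum {R : Type*} [Ring R] (x : Fin p × Bool → R) (n : ℕ) : R :=
  ∑ w ∈ words p n, if FreeGroup.IsReduced w then (w.map x).prod else 0

variable {R : Type*} [Ring R] (x : Fin p × Bool → R)

theorem reducedSum_zero : reducedSum x 0 = 1 := by
  simp [reducedSum, words]

theorem reducedSum_succ (n : ℕ) : reducedSum x (n + 1) = ∑ a, reducedSumFrom x n a := by
  rw [reducedSum, sum_words_succ]
  rfl

theorem reducedSumFrom_zero (a : Fin p × Bool) : reducedSumFrom x 0 a = x a := by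
  simp [reducedSumFrom, words]

theorem reducedSumFrom_succ (n : ℕ) (a : Fin p × Bool) :
    reducedSumFrom x (n + 1) a =
      x a * (reducedSum x (n + 1) - reducedSumFrom x n (flipLetter a)) := by
  rw [reducedSum_succ, ← Finset.sum_erase_eq_sub (Finset.mem_univ _), reducedSumFrom,
    sum_words_succ, ← Finset.sum_erase_add _ _ (Finset.mem_univ (flipLetter a)), Finset.mul_sum]
  classical
  have h0 : ∑ w ∈ words p n, (if FreeGroup.IsReduced (a :: flipLetter a :: w) then
      ((a :: flipLetter a :: w).map x).prod else 0) = 0 :=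
    Finset.sum_eq_zero fun w _ => by simp [-FreeGroup.isReduced_cons_cons, isReduced_cons_cons_iff]
  rw [h0, add_zero]
  refine Finset.sum_congr rfl fun b hb => ?_
  rw [reducedSumFrom, Finset.mul_sum]
  refine Finset.sum_congr rfl fun w _ => ?_
  have hb : b ≠ flipLetter a := Finset.ne_of_mem_erase hb
  simp [-FreeGroup.isReduced_cons_cons, isReduced_cons_cons_iff, hb]

theorem reducedSum_one : reducedSum x 1 = ∑ a, x a := by
  simp [reducedSum_succ, reducedSumFrom_zero]

theorem reducedSum_two (hx : ∀ a, x a * x (flipLetter a) = 1) :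
    reducedSum x 2 = (∑ a, x a) ^ 2 - 2 * (p : R) := by
  rw [reducedSum_succ]
  simp only [reducedSumFrom_succ, reducedSumFrom_zero, mul_sub, hx, Finset.sum_sub_distrib,
    ← Finset.sum_mul]
  simp [sq, reducedSum_one, Nat.cast_comm]

/-- Prefixing any letter `a` overcounts the words in which `a` is followed by its inverse.
Cancelling that pair leaves a reduced word not starting with `a`, and each nonempty word arises from
2p - 1 letters. At length 2 the remaining word is empty and arises from all 2p, hence the
exceptional third case of `reducedPoly`. -/
theorem reducedSum_add_three (hx : ∀ a, x a * x (flipLetter a) = 1) (n : ℕ) :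
    reducedSum x (n + 3) =
      (∑ a, x a) * reducedSum x (n + 2) - (2 * (p : R) - 1) * reducedSum x (n + 1) := by
  have h : ∀ a, x a * reducedSumFrom x (n + 1) (flipLetter a) =
      reducedSum x (n + 1) - reducedSumFrom x n a := fun a => by
    rw [reducedSumFrom_succ, ← mul_assoc, hx, one_mul, flipLetter_flipLetter]
  rw [reducedSum_succ]
  simp only [reducedSumFrom_succ x (n + 1), mul_sub, h, Finset.sum_sub_distrib, ← Finset.sum_mul,
    ← reducedSum_succ]
  simp [sub_mul, Nat.cast_comm]

/-- The polynomials expressing the sum of all reduced words of length `n` through the normalized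
sum of the letters; `q + 1` is the number of letters. -/
def reducedPoly (q : ℝ) : ℕ → ℝ[X]
  | 0 => 1
  | 1 => C (q + 1) * X
  | 2 => (C (q + 1) * X) ^ 2 - C (q + 1)
  | n + 3 => C (q + 1) * X * reducedPoly q (n + 2) - C q * reducedPoly q (n + 1)

theorem aeval_reducedPoly [Algebra ℝ R] (hx : ∀ a, x a * x (flipLetter a) = 1) (M : R)
    (hM : (2 * p : ℝ) • M = ∑ a, x a) (n : ℕ) :
    aeval M (reducedPoly (2 * p - 1) n) = reducedSum x n := by
  have hM' : algebraMap ℝ R (2 * p) * M = ∑ a, x a := by rw [← Algebra.smul_def, hM]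
  have h2 : algebraMap ℝ R (2 * p) = 2 * (p : R) := by simp [map_ofNat]
  induction n using Nat.strong_induction_on with
  | _ n ih =>
    match n with
    | 0 => simp [reducedPoly, reducedSum_zero]
    | 1 => rw [reducedPoly, reducedSum_one, map_mul, aeval_C, aeval_X, sub_add_cancel, hM']
    | 2 =>
      rw [reducedPoly, reducedSum_two x hx, map_sub, map_pow, map_mul, aeval_C, aeval_X,
        sub_add_cancel, hM', h2]
    | n + 3 =>
      rw [reducedPoly, reducedSum_add_three x hx, map_sub, map_mul, map_mul, map_mul, aeval_C,
        aeval_C, aeval_X, sub_add_cancel, hM', ih _ (by omega), ih _ (by omega), map_sub, h2,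
        map_one]

/-- The number of reduced words of length `n + 1` on `2p` letters is `2p (2p - 1) ^ n`. -/
theorem reducedSum_one_succ (n : ℕ) :
    reducedSum (fun _ : Fin p × Bool => (1 : ℝ)) (n + 1) = 2 * p * (2 * p - 1) ^ n := by
  induction n with
  | zero => simp [reducedSum_one, mul_comm]
  | succ n ih =>
    have h : ∑ a, reducedSumFrom (fun _ : Fin p × Bool => (1 : ℝ)) n (flipLetter a) =
        reducedSum (fun _ : Fin p × Bool => (1 : ℝ)) (n + 1) := by
      rw [reducedSum_succ]
      exact flipLetter_bijective.sum_comp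
        (reducedSumFrom (fun _ : Fin p × Bool => (1 : ℝ)) n)
    rw [reducedSum_succ]
    simp only [reducedSumFrom_succ, one_mul, Finset.sum_sub_distrib, h]
    rw [ih]
    simp
    ring

end Words

/-! ### Moments as sums over words -/

section WordMoments

variable {H : Type*} [NormedAddCommGroup H] [InnerProductSpace ℂ H] {p : ℕ}
  {x : Fin p × Bool → H →L[ℂ] H} {M : H →L[ℂ] H}

theorem real_smul_of_complex_smul (hM : (2 * p : ℂ) • M = ∑ a, x a) :
    (2 * p : ℝ) • M = ∑ a, x a := by
  rw [← hM, ← Complex.coe_smul]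
  simp

theorem moment_X_pow (hM : (2 * p : ℂ) • M = ∑ a, x a) (v : H) (n : ℕ) :
    (2 * p) ^ n * moment M v (X ^ n) =
      ∑ w ∈ words p n, (⟪v, (w.map x).prod v⟫_ℂ).re := by
  have h : (2 * p : ℝ) ^ n • M ^ n = ∑ w ∈ words p n, (w.map x).prod := by
    rw [← _root_.smul_pow, real_smul_of_complex_smul hM, sum_words_prod]
  rw [← smul_eq_mul, ← map_smul, moment_apply, map_smul, map_pow, aeval_X, h, sum_apply, inner_sum,
    Complex.re_sum]

open Classical in
theorem moment_reducedPoly (hx : ∀ a, x a * x (flipLetter a) = 1)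
    (hM : (2 * p : ℂ) • M = ∑ a, x a) (v : H) (n : ℕ) :
    moment M v (reducedPoly (2 * p - 1) n) =
      ∑ w ∈ words p n, if FreeGroup.IsReduced w then (⟪v, (w.map x).prod v⟫_ℂ).re else 0 := by
  rw [moment_apply, aeval_reducedPoly x hx _ (real_smul_of_complex_smul hM), reducedSum, sum_apply,
    inner_sum, Complex.re_sum]
  refine Finset.sum_congr rfl fun w _ => ?_
  split_ifs <;> simp

end WordMoments

/-! ### Cogrowth functions as moments of the Markov operator -/

section Counting

variable {G : Type*} [Group G] {p : ℕ} (s : Fin p → G)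

/-- The group element represented by a letter. -/
def letterEval (a : Fin p × Bool) : G := if a.2 then s a.1 else (s a.1)⁻¹

theorem letterEval_flipLetter (a : Fin p × Bool) :
    letterEval s (flipLetter a) = (letterEval s a)⁻¹ := by
  obtain ⟨i, b⟩ := a
  cases b <;> simp [letterEval, flipLetter]

theorem wordEval_eq (w : List (Fin p × Bool)) : wordEval s w = (w.map (letterEval s)).prod := rfl

open Classical in
theorem cogrowth_eq_sum (n : ℕ) :
    (cogrowth s n : ℝ) = ∑ w ∈ words p n, if wordEval s w = 1 then 1 else 0 := by
  have : {w : List (Fin p × Bool) | w.length = n ∧ wordEval s w = 1} =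
      ((words p n).filter fun w => wordEval s w = 1 : Finset _) := by
    ext w
    simp [mem_words]
  rw [cogrowth, this, Set.ncard_coe_finset, Finset.sum_boole]

open Classical in
theorem reducedCogrowth_eq_sum (n : ℕ) :
    (reducedCogrowth s n : ℝ) = ∑ w ∈ words p n,
      if FreeGroup.IsReduced w then (if wordEval s w = 1 then 1 else 0) else 0 := by
  have : {w : List (Fin p × Bool) | w.length = n ∧ FreeGroup.IsReduced w ∧ wordEval s w = 1} =
      ((words p n).filter fun w => FreeGroup.IsReduced w ∧ wordEval s w = 1 : Finset _) := by
    ext w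
    simp [mem_words]
  rw [reducedCogrowth, this, Set.ncard_coe_finset, ← Finset.sum_boole]
  refine Finset.sum_congr rfl fun w _ => ?_
  by_cases h : FreeGroup.IsReduced w <;> simp [h]

/-- The translation operator of a letter. -/
def letterOp (a : Fin p × Bool) : EllTwo G →L[ℂ] EllTwo G := regularRep G (letterEval s a)

theorem letterOp_mul_flip (a : Fin p × Bool) : letterOp s a * letterOp s (flipLetter a) = 1 := by
  rw [letterOp, letterOp, ← map_mul, letterEval_flipLetter, mul_inv_cancel, map_one]

theorem prod_letterOp (w : List (Fin p × Bool)) :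
    (w.map (letterOp s)).prod = regularRep G (wordEval s w) := by
  rw [wordEval_eq, map_list_prod, List.map_map]
  rfl

/-- The Markov operator of the simple random walk. -/
def markov : EllTwo G →L[ℂ] EllTwo G := (2 * p : ℂ)⁻¹ • ∑ a, letterOp s a

theorem isSelfAdjoint_markov : IsSelfAdjoint (markov s) := by
  refine IsSelfAdjoint.smul (by simp [IsSelfAdjoint]) ?_
  rw [IsSelfAdjoint, star_sum]
  simp only [letterOp, adjoint_regularRep, ← letterEval_flipLetter]
  exact flipLetter_bijective.sum_comp fun a => regularRep G (letterEval s a)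

theorem norm_markov_le : ‖markov s‖ ≤ 1 := by
  have h : ‖∑ a, letterOp s a‖ ≤ 2 * p := by
    refine (norm_sum_le _ _).trans ((Finset.sum_le_sum fun a _ => norm_regularRep_le _).trans ?_)
    simp [mul_comm]
  have h2 : ‖(2 * p : ℂ)⁻¹‖ = (2 * p : ℝ)⁻¹ := by simp
  rw [markov, norm_smul, h2]
  exact inv_mul_le_one_of_le₀ h (by positivity)

theorem moment_regularRep_pointMass [DecidableEq G] (g x : G) :
    (⟪pointMass g, regularRep G x (pointMass g)⟫_ℂ).re = if x = 1 then 1 else 0 := by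
  simp only [inner_regularRep_pointMass, mul_eq_left]
  split_ifs <;> simp

variable [NeZero p]

theorem smul_markov : (2 * p : ℂ) • markov s = ∑ a, letterOp s a := by
  rw [markov, smul_inv_smul₀]
  simp [NeZero.ne]

theorem moment_pow_pointMass (g : G) (n : ℕ) :
    moment (markov s) (pointMass g) (X ^ n) = cogrowth s n / (2 * p) ^ n := by
  classical
  have hp : (2 * p : ℝ) ^ n ≠ 0 := by simp [NeZero.ne]
  rw [eq_div_iff hp, mul_comm, moment_X_pow (smul_markov s), cogrowth_eq_sum]
  simp only [prod_letterOp, moment_regularRep_pointMass]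

theorem moment_reducedPoly_pointMass (g : G) (n : ℕ) :
    moment (markov s) (pointMass g) (reducedPoly (2 * p - 1) n) = reducedCogrowth s n := by
  classical
  rw [moment_reducedPoly (letterOp_mul_flip s) (smul_markov s), reducedCogrowth_eq_sum]
  simp only [prod_letterOp, moment_regularRep_pointMass]

omit [NeZero p] in
theorem cogrowth_le (n : ℕ) : (cogrowth s n : ℝ) ≤ (2 * p) ^ n := by
  classical
  have h := sum_words_prod (fun _ : Fin p × Bool => (1 : ℝ)) n
  rw [cogrowth_eq_sum]
  refine (Finset.sum_le_sum (g := fun _ => (1 : ℝ)) fun w _ => by split_ifs <;> simp).trans ?_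
  simpa [mul_comm] using h.le

omit [NeZero p] in
theorem reducedCogrowth_succ_le (n : ℕ) :
    (reducedCogrowth s (n + 1) : ℝ) ≤ 2 * p * (2 * p - 1) ^ n := by
  classical
  rw [reducedCogrowth_eq_sum, ← reducedSum_one_succ, reducedSum]
  refine Finset.sum_le_sum fun w _ => ?_
  split_ifs <;> simp

end Counting

/-! ### Scalar estimates for the reduced polynomials -/

section Scalar

/-- The complete homogeneous symmetric polynomial of degree `n` in two variables. -/
def hsum {K : Type*} [CommRing K] (z w : K) : ℕ → K
  | 0 => 1
  | n + 1 => z ^ (n + 1) + w * hsum z w n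

theorem hsum_add_two {K : Type*} [CommRing K] (z w : K) (n : ℕ) :
    hsum z w (n + 2) = (z + w) * hsum z w (n + 1) - z * w * hsum z w n := by
  simp only [hsum]
  ring

/-- Both sides satisfy the same recurrence. The ring `K` is general because the roots are complex
for small |x| and real otherwise. -/
theorem map_eval_reducedPoly {K : Type*} [CommRing K] (f : ℝ →+* K) {q x : ℝ} {z w : K}
    (h1 : z + w = f ((q + 1) * x)) (h2 : z * w = f q) (n : ℕ) :
    f ((reducedPoly q (n + 2)).eval x) = hsum z w (n + 2) - hsum z w n := by
  induction n using Nat.strong_induction_on with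
  | _ n ih =>
    match n with
    | 0 =>
      simp only [reducedPoly, eval_sub, eval_pow, eval_mul, eval_C, eval_X, map_sub, map_pow,
        hsum]
      rw [← h1, map_add, ← h2, map_one]
      ring
    | 1 =>
      simp only [reducedPoly, eval_sub, eval_pow, eval_mul, eval_C, eval_X, hsum]
      generalize (q + 1) * x = y at *
      rw [map_sub, map_mul, map_mul, map_sub, map_pow, ← h1, map_add, ← h2, map_one]
      ring
    | n + 2 =>
      have h : (reducedPoly q (n + 4)).eval x = (q + 1) * x * (reducedPoly q (n + 3)).eval x -
          q * (reducedPoly q (n + 2)).eval x := by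
        rw [reducedPoly]
        simp only [eval_sub, eval_mul, eval_C, eval_X]
      rw [h, map_sub, map_mul, map_mul f q, ← h1, ← h2, ih (n + 1) (by omega),
        ih n (by omega), hsum_add_two z w (n + 2), hsum_add_two z w n]
      ring

theorem norm_hsum_le {K : Type*} [NormedField K] {z w : K} {r : ℝ} (hz : ‖z‖ ≤ r) (hw : ‖w‖ ≤ r)
    (n : ℕ) : ‖hsum z w n‖ ≤ (n + 1) * r ^ n := by
  have hr : 0 ≤ r := (norm_nonneg z).trans hz
  induction n with
  | zero => simp [hsum]
  | succ n ih =>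
    calc ‖hsum z w (n + 1)‖ ≤ ‖z‖ ^ (n + 1) + ‖w‖ * ‖hsum z w n‖ := by
          rw [hsum]
          exact (norm_add_le _ _).trans (by rw [norm_pow, norm_mul])
      _ ≤ r ^ (n + 1) + r * ((n + 1) * r ^ n) := by gcongr
      _ = _ := by push_cast; ring

theorem hsum_nonneg {z w : ℝ} (hz : 0 ≤ z) (hw : 0 ≤ w) (n : ℕ) : 0 ≤ hsum z w n := by
  induction n with
  | zero => simp [hsum]
  | succ n ih => rw [hsum]; positivity

/-- A geometric sum of ratio at most 1/2; unlike `norm_hsum_le` it loses no factor n + 1. -/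
theorem hsum_le_two_mul_pow {z w : ℝ} (hw : 0 ≤ w) (h : 2 * w ≤ z) (n : ℕ) :
    hsum z w n ≤ 2 * z ^ n := by
  have hz : 0 ≤ z := by linarith
  induction n with
  | zero => simp [hsum]
  | succ n ih =>
    calc hsum z w (n + 1) ≤ z ^ (n + 1) + w * (2 * z ^ n) := by rw [hsum]; gcongr
      _ = z ^ (n + 1) + (2 * w) * z ^ n := by ring
      _ ≤ z ^ (n + 1) + z * z ^ n := by gcongr
      _ = _ := by ring

theorem eval_neg_reducedPoly (q x : ℝ) (n : ℕ) :
    (reducedPoly q n).eval (-x) = (-1) ^ n * (reducedPoly q n).eval x := by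
  induction n using Nat.strong_induction_on with
  | _ n ih =>
    match n with
    | 0 => simp [reducedPoly]
    | 1 => simp [reducedPoly]
    | 2 => simp [reducedPoly]
    | n + 3 =>
      simp only [reducedPoly, eval_sub, eval_mul, eval_C, eval_X, ih (n + 2) (by omega),
        ih (n + 1) (by omega)]
      ring

theorem eval_abs_reducedPoly (q x : ℝ) (k : ℕ) :
    (reducedPoly q (2 * k)).eval |x| = (reducedPoly q (2 * k)).eval x := by
  rcases abs_choice x with h | h <;> simp [h, eval_neg_reducedPoly]

/-- For `x` in the elliptic range the reduced polynomials are exponentially small. -/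
theorem abs_eval_reducedPoly_le {q x : ℝ} (hq : 3 ≤ q) (hx : ((q + 1) * x / 2) ^ 2 ≤ q) (k : ℕ) :
    |(reducedPoly q (2 * k)).eval x| ≤ q ^ (2 * k) * (2 * (2 * k + 1) * (2 / 3) ^ k) := by
  rcases k with _ | k
  · simp [reducedPoly]
  set y := (q + 1) * x / 2 with hy
  -- The roots are the conjugate pair y ± iu, of modulus √q.
  set u := √(q - y ^ 2) with hu
  have hu2 : u ^ 2 = q - y ^ 2 := Real.sq_sqrt (by linarith)
  have hz : ‖(⟨y, u⟩ : ℂ)‖ ≤ √q := by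
    rw [Complex.norm_def, Complex.normSq_mk]
    exact Real.sqrt_le_sqrt (by nlinarith)
  have hw : ‖(⟨y, -u⟩ : ℂ)‖ ≤ √q := by
    rw [Complex.norm_def, Complex.normSq_mk]
    exact Real.sqrt_le_sqrt (by nlinarith)
  have h := map_eval_reducedPoly Complex.ofRealHom (q := q) (x := x) (z := ⟨y, u⟩) (w := ⟨y, -u⟩)
    (by apply Complex.ext <;> simp [hy])
    (by apply Complex.ext <;> simp
        · nlinarith
        · ring) (2 * k)
  have hk : 2 * (k + 1) = 2 * k + 2 := by ring
  have hs : √q ^ (2 * k) = q ^ k := by rw [pow_mul, Real.sq_sqrt (by linarith)]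
  have hs2 : √q ^ (2 * k + 2) = q ^ k * q := by rw [pow_add, hs, Real.sq_sqrt (by linarith)]
  rw [hk, ← Real.norm_eq_abs, ← Complex.norm_real]
  calc _ ≤ ‖hsum (⟨y, u⟩ : ℂ) ⟨y, -u⟩ (2 * k + 2)‖ + ‖hsum (⟨y, u⟩ : ℂ) ⟨y, -u⟩ (2 * k)‖ := by
        refine le_of_eq_of_le ?_ (norm_sub_le _ _)
        rw [← h]
        rfl
    _ ≤ ((2 * k + 2 : ℕ) + 1) * √q ^ (2 * k + 2) + ((2 * k : ℕ) + 1) * √q ^ (2 * k) := by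
        gcongr <;> exact norm_hsum_le hz hw _
    _ = (2 * k + 3) * (q ^ k * q) + (2 * k + 1) * (q ^ k * 1) := by
        rw [hs, hs2]; push_cast; ring
    _ ≤ (2 * k + 3) * (q ^ k * q) + (2 * k + 3) * (q ^ k * q) := by
        gcongr <;> linarith
    _ = 2 * (2 * (k + 1 : ℕ) + 1) * q ^ (k + 1) := by push_cast; ring
    _ ≤ 2 * (2 * (k + 1 : ℕ) + 1) * (q ^ 2 * (2 / 3)) ^ (k + 1) := by
        gcongr
        nlinarith
    _ = _ := by rw [mul_pow, ← pow_mul, hk]; ring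

/-- The parametrization of the hyperbolic range. -/
theorem exists_roots {q x : ℝ} (hq : 3 ≤ q) (hx0 : 0 ≤ x) (hx1 : x ≤ 1)
    (hx : q ≤ ((q + 1) * x / 2) ^ 2) :
    ∃ z w : ℝ, z + w = (q + 1) * x ∧ z * w = q ∧ 1 ≤ w ∧ w ≤ z := by
  set y := (q + 1) * x / 2 with hy
  set u := √(y ^ 2 - q) with hu
  have hu2 : u ^ 2 = y ^ 2 - q := Real.sq_sqrt (by linarith)
  have hu0 : 0 ≤ u := Real.sqrt_nonneg _
  have hy0 : 0 ≤ y := by positivity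
  have hy1 : 1 ≤ y := by nlinarith
  have hyq : 2 * y ≤ q + 1 := by nlinarith
  refine ⟨y + u, y - u, by rw [hy]; ring, by nlinarith, ?_, by linarith⟩
  -- Squaring reduces this to 2y ≤ q + 1, that is x ≤ 1.
  have : u ≤ y - 1 := Real.sqrt_le_iff.2 ⟨by linarith, by nlinarith⟩
  linarith

theorem eval_reducedPoly_le_hsum {q x z w : ℝ} (h1 : z + w = (q + 1) * x) (h2 : z * w = q)
    (hw : 0 ≤ w) (hz : 0 ≤ z) (k : ℕ) :
    (reducedPoly q (2 * k)).eval x ≤ hsum z w (2 * k) := by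
  rcases k with _ | k
  · simp [reducedPoly, hsum]
  have := map_eval_reducedPoly (RingHom.id ℝ) h1 h2 (2 * k)
  rw [RingHom.id_apply] at this
  rw [mul_add, mul_one, this]
  linarith [hsum_nonneg hz hw (2 * k)]

/-- Unfolding `hsum` twice, the subtracted sum is absorbed by its copy with coefficient w² ≥ 1. -/
theorem pow_le_eval_reducedPoly {q x z w : ℝ} (h1 : z + w = (q + 1) * x) (h2 : z * w = q)
    (hw : 1 ≤ w) (hz : 0 ≤ z) (k : ℕ) :
    z ^ (2 * k) ≤ (reducedPoly q (2 * k)).eval x := by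
  rcases k with _ | k
  · simp [reducedPoly]
  have := map_eval_reducedPoly (RingHom.id ℝ) h1 h2 (2 * k)
  rw [RingHom.id_apply] at this
  rw [mul_add, mul_one, this, hsum, hsum]
  have h0 := hsum_nonneg hz (by linarith : 0 ≤ w) (2 * k)
  have h3 : 0 ≤ w * z ^ (2 * k + 1) := by positivity
  have h4 : 0 ≤ (w ^ 2 - 1) * hsum z w (2 * k) := mul_nonneg (by nlinarith) h0
  nlinarith

theorem eval_reducedPoly_le {q x : ℝ} (hq : 3 ≤ q) (hx : |x| ≤ 1) (k : ℕ) :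
    (reducedPoly q (2 * k)).eval x ≤
      q ^ (2 * k) * (2 * x ^ (2 * k) + 2 * (2 * k + 1) * (2 / 3) ^ k) := by
  rw [← eval_abs_reducedPoly, ← Even.pow_abs (even_two_mul k) x]
  have hx0 := abs_nonneg x
  generalize |x| = x at *
  rcases le_total (((q + 1) * x / 2) ^ 2) q with h | h
  · refine (le_abs_self _).trans ((abs_eval_reducedPoly_le hq h k).trans ?_)
    gcongr
    simp only [le_add_iff_nonneg_left]
    positivity
  obtain ⟨z, w, h1, h2, hw, hwz⟩ := exists_roots hq hx0 hx h
  have hz0 : 0 ≤ z := by linarith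
  refine (eval_reducedPoly_le_hsum h1 h2 (by linarith) hz0 k).trans ?_
  rcases le_total (2 * w) z with h3 | h3
  -- Multiplied by q + 1, this reads z ≤ qw = zw², true since w ≥ 1.
  · have hzx : z ≤ q * x := by nlinarith
    calc hsum z w (2 * k) ≤ 2 * z ^ (2 * k) := hsum_le_two_mul_pow (by linarith) h3 _
      _ ≤ 2 * (q * x) ^ (2 * k) := by gcongr
      _ = q ^ (2 * k) * (2 * x ^ (2 * k)) := by rw [mul_pow]; ring
      _ ≤ _ := by
        gcongr
        simp only [le_add_iff_nonneg_right]
        positivity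
  -- Here z² ≤ 2zw = 2q, and q ≥ 3; this fixes the ratio 2/3.
  · have hz2 : z ^ 2 ≤ q ^ 2 * (2 / 3) := by nlinarith
    calc hsum z w (2 * k) ≤ ((2 * k : ℕ) + 1) * z ^ (2 * k) := by
          refine (le_abs_self _).trans (norm_hsum_le (K := ℝ) ?_ ?_ _)
          · rw [Real.norm_of_nonneg hz0]
          · rw [Real.norm_of_nonneg (by linarith)]
            exact hwz
      _ = (2 * k + 1) * (z ^ 2) ^ k := by rw [pow_mul]; push_cast; ring
      _ ≤ (2 * k + 1) * (q ^ 2 * (2 / 3)) ^ k := by gcongr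
      _ = q ^ (2 * k) * ((2 * k + 1) * (2 / 3) ^ k) := by rw [mul_pow, ← pow_mul]; ring
      _ ≤ _ := by
        gcongr
        have : 0 ≤ (2 * k + 1 : ℝ) * (2 / 3) ^ k := by positivity
        have : 0 ≤ x ^ (2 * k) := by positivity
        linarith

/-- As q = zw, the claim is x^K w ≤ 1. With v = 1 - x one has (q + 1)v = (z - 1)(w - 1) and z ≥ 3/2,
so w ≤ 1 + Kv ≤ (1 + v)^K by Bernoulli, while x(1 + v) = 1 - v² ≤ 1. -/
theorem mul_pow_le_root {q x z w : ℝ} (hq : 3 ≤ q) (hx1 : x ≤ 1) (hx0 : 0 ≤ x)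
    (h1 : z + w = (q + 1) * x) (h2 : z * w = q) (hw : 1 ≤ w) (hwz : w ≤ z) {K : ℕ}
    (hK : 2 * (q + 1) ≤ K) : q * x ^ K ≤ z := by
  have hz : 3 / 2 ≤ z := by nlinarith
  set v := 1 - x with hv
  have hv1 : (q + 1) * v = (z - 1) * (w - 1) := by rw [hv]; linarith
  have hwv : w ≤ 1 + K * v := by
    have : 2 * (q + 1) * v ≤ K * v := by
      gcongr
    nlinarith
  have hb : 1 + K * v ≤ (1 + v) ^ K := one_add_mul_le_pow (by linarith) K
  have hxw : x ^ K * w ≤ 1 :=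
    calc x ^ K * w ≤ x ^ K * (1 + v) ^ K := by gcongr; exact hwv.trans hb
      _ = (x * (1 + v)) ^ K := (mul_pow _ _ _).symm
      _ ≤ 1 := pow_le_one₀ (mul_nonneg hx0 (by linarith)) (by nlinarith)
  calc q * x ^ K = z * (x ^ K * w) := by rw [← h2]; ring
    _ ≤ z * 1 := by gcongr
    _ = z := mul_one z

theorem pow_le_eval_reducedPoly_add {q x : ℝ} (hq : 3 ≤ q) (hx : |x| ≤ 1) {K m n : ℕ}
    (hK : 2 * (q + 1) ≤ K) (hmn : K * m ≤ n) :
    q ^ (2 * m) * x ^ (2 * n) ≤ (reducedPoly q (2 * m)).eval x +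
      q ^ (2 * m) * ((4 * q / (q + 1) ^ 2) ^ n + 2 * (2 * m + 1) * (2 / 3) ^ m) := by
  rw [← eval_abs_reducedPoly, ← Even.pow_abs (even_two_mul n) x]
  have hx0 := abs_nonneg x
  generalize |x| = x at *
  rcases le_total (((q + 1) * x / 2) ^ 2) q with h | h
  · have h1 := neg_le_of_abs_le (abs_eval_reducedPoly_le hq h m)
    have h2 : x ^ 2 ≤ 4 * q / (q + 1) ^ 2 := by
      rw [le_div_iff₀ (by positivity)]
      linarith
    have h3 : x ^ (2 * n) ≤ (4 * q / (q + 1) ^ 2) ^ n := by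
      rw [pow_mul]
      gcongr
    have h4 := mul_le_mul_of_nonneg_left h3 (by positivity : 0 ≤ q ^ (2 * m))
    rw [mul_add]
    linarith
  obtain ⟨z, w, h1, h2, hw, hwz⟩ := exists_roots hq hx0 hx h
  have hz0 : 0 ≤ z := by linarith
  refine le_add_of_le_of_nonneg ?_ (by positivity)
  calc q ^ (2 * m) * x ^ (2 * n) ≤ q ^ (2 * m) * x ^ (K * (2 * m)) := by
        gcongr ?_ * ?_
        exact pow_le_pow_of_le_one hx0 hx (by linarith)
    _ = (q * x ^ K) ^ (2 * m) := by rw [mul_pow, pow_mul x]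
    _ ≤ z ^ (2 * m) := by
        gcongr
        exact mul_pow_le_root hq hx hx0 h1 h2 hw hwz hK
    _ ≤ _ := pow_le_eval_reducedPoly h1 h2 hw hz0 m

end Scalar

/-! ### Følner sets and subexponential decay -/

section Amenable

variable {G : Type*} [Group G]

/-- The indicator function of a finite set, as an element of `ℓ²(G)`. -/
def indicatorVec (F : Finset G) : EllTwo G := ∑ g ∈ F, pointMass g

theorem inner_indicatorVec [DecidableEq G] (F : Finset G) (x : G) :
    (⟪indicatorVec F, regularRep G x (indicatorVec F)⟫_ℂ).re =
      (F.filter fun g => g * x ∈ F).card := by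
  simp only [indicatorVec, map_sum, sum_inner, inner_sum, inner_regularRep_pointMass]
  rw [Finset.sum_comm]
  simp

theorem boundary_finite (T F : Finset G) : (boundary T F).Finite := by
  classical
  refine ((F ×ˢ T).image fun x => x.1 * x.2⁻¹).finite_toSet.subset ?_
  rintro g ⟨-, t, ht, hg⟩
  simp only [Finset.coe_image, Finset.coe_product, Set.mem_image, Set.mem_prod, Finset.mem_coe]
  exact ⟨(g * t, t), ⟨hg, ht⟩, by simp⟩

/-- Translation by `x` injects the points of `F` that leave `F` into the boundary, since `x⁻¹`
brings them back. -/
theorem card_le_card_filter_add_boundary [DecidableEq G] {T F : Finset G} {x : G}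
    (hx : x⁻¹ ∈ T) :
    F.card ≤ (F.filter fun g => g * x ∈ F).card + (boundary T F).ncard := by
  rw [← Finset.card_filter_add_card_filter_not (s := F) (fun g => g * x ∈ F)]
  gcongr
  rw [← Set.ncard_coe_finset]
  refine Set.ncard_le_ncard_of_injOn (fun g => g * x) ?_ (mul_left_injective x).injOn
    (boundary_finite T F)
  intro g hg
  simp only [Finset.coe_filter, Set.mem_ofPred_eq] at hg
  exact ⟨hg.2, x⁻¹, hx, by simpa using hg.1⟩

variable {p : ℕ} (s : Fin p → G)

theorem words_one_sum {R : Type*} [AddCommMonoid R] (f : List (Fin p × Bool) → R) :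
    ∑ w ∈ words p 1, f w = ∑ a, f [a] := by
  rw [sum_words_succ]
  simp [words]

theorem letterEval_inv_mem [DecidableEq G] (a : Fin p × Bool) :
    (letterEval s a)⁻¹ ∈ Finset.univ.image (letterEval s) := by
  rw [← letterEval_flipLetter]
  exact Finset.mem_image_of_mem _ (Finset.mem_univ _)

theorem moment_one_indicatorVec (F : Finset G) :
    moment (markov s) (indicatorVec F) 1 = F.card := by
  classical
  have := inner_indicatorVec F 1
  rw [moment_apply, map_one]
  rw [map_one] at this
  rw [this]
  congr 2
  rw [Finset.filter_eq_self]
  simp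

variable [NeZero p]

theorem moment_X_indicatorVec [DecidableEq G] (F : Finset G) :
    (F.card : ℝ) - (boundary (Finset.univ.image (letterEval s)) F).ncard ≤
      moment (markov s) (indicatorVec F) X := by
  have h := moment_X_pow (smul_markov s) (indicatorVec F) 1
  simp only [pow_one, words_one_sum, prod_letterOp, inner_indicatorVec] at h
  have hp : (0 : ℝ) < 2 * p := by simp [NeZero.pos]
  refine le_of_mul_le_mul_left ?_ hp
  rw [h]
  have : ∑ _a : Fin p × Bool, ((F.card : ℝ) -
      (boundary (Finset.univ.image (letterEval s)) F).ncard) ≤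
      ∑ a : Fin p × Bool, ((F.filter fun g => g * wordEval s [a] ∈ F).card : ℝ) := by
    refine Finset.sum_le_sum fun a _ => ?_
    have := card_le_card_filter_add_boundary (F := F) (letterEval_inv_mem s a)
    rw [sub_le_iff_le_add]
    have h1 : wordEval s [a] = letterEval s a := by simp [wordEval_eq]
    rw [h1]
    exact_mod_cast this
  refine le_trans (le_of_eq ?_) this
  simp
  ring

/-- The norm of M^k δ_g does not depend on g, so the triangle inequality costs only a factor
independent of k. -/
theorem moment_pow_indicatorVec_le (F : Finset G) (k : ℕ) :
    moment (markov s) (indicatorVec F) (X ^ (2 * k)) ≤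
      (F.card : ℝ) ^ 2 * (cogrowth s (2 * k) / (2 * p) ^ (2 * k)) := by
  have hS := isSelfAdjoint_markov s
  have h : ∀ g, ‖(markov s ^ k) (pointMass g)‖ =
      √(cogrowth s (2 * k) / (2 * p) ^ (2 * k)) := fun g => by
    rw [← moment_pow_pointMass s g, moment_X_pow_two_mul hS, Real.sqrt_sq (norm_nonneg _)]
  rw [moment_X_pow_two_mul hS, ← Real.sq_sqrt (by positivity :
    (0 : ℝ) ≤ cogrowth s (2 * k) / (2 * p) ^ (2 * k)), ← mul_pow]
  gcongr
  rw [indicatorVec, map_sum]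
  refine (norm_sum_le _ _).trans ?_
  simp only [h, Finset.sum_const, nsmul_eq_mul, le_refl]

/-- In an amenable group the return probabilities decay subexponentially. -/
theorem exists_mul_pow_le_cogrowth (hG : IsAmenable G) {r : ℝ} (hr0 : 0 ≤ r) (hr1 : r < 1) :
    ∃ c : ℝ, 0 < c ∧ ∀ k : ℕ, c * r ^ (2 * k) ≤ cogrowth s (2 * k) / (2 * p) ^ (2 * k) := by
  classical
  obtain ⟨F, hF, hlim⟩ := hG (Finset.univ.image (letterEval s))
  -- Boundary ratio below 1 - r makes the Rayleigh quotient of the indicator at least r, ready for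
  -- Jensen.
  obtain ⟨n, hn⟩ := (hlim.eventually_lt_const (by linarith : 0 < 1 - r)).exists
  have hc : (0 : ℝ) < (F n).card := by exact_mod_cast (hF n).card_pos
  rw [div_lt_iff₀ hc] at hn
  refine ⟨((F n).card : ℝ)⁻¹, by positivity, fun k => ?_⟩
  have h1 := pow_mul_le_moment (isSelfAdjoint_markov s) (norm_markov_le s) (indicatorVec (F n)) k r
    hr0 (by
      rw [moment_one_indicatorVec]
      have := moment_X_indicatorVec s (F n)
      linarith)
  rw [moment_one_indicatorVec] at h1
  have h2 := h1.trans (moment_pow_indicatorVec_le s (F n) k)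
  rw [inv_mul_le_iff₀ hc]
  refine le_of_mul_le_mul_left ?_ hc
  linarith

end Amenable

/-! ### Changing parity with an odd relator -/

section OddWords

variable {G : Type*} [Group G] {p : ℕ} (s : Fin p → G)

theorem wordEval_eq_lift (w : List (Fin p × Bool)) :
    wordEval s w = FreeGroup.lift s (FreeGroup.mk w) := by
  rw [FreeGroup.lift_mk, wordEval]
  congr 2
  ext ⟨i, b⟩
  cases b <;> rfl

theorem wordEval_append (v w : List (Fin p × Bool)) :
    wordEval s (v ++ w) = wordEval s v * wordEval s w := by
  simp [wordEval]

theorem wordEval_invRev (w : List (Fin p × Bool)) :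
    wordEval s (FreeGroup.invRev w) = (wordEval s w)⁻¹ := by
  rw [wordEval_eq_lift, ← FreeGroup.inv_mk, map_inv, ← wordEval_eq_lift]

theorem finite_words (n : ℕ) (P : List (Fin p × Bool) → Prop) :
    {w : List (Fin p × Bool) | w.length = n ∧ P w}.Finite :=
  (words p n).finite_toSet.subset fun _ hw => Finset.mem_coe.2 (mem_words.2 hw.1)

/-- Free reduction and removal of a conjugator both delete an even number of letters. -/
theorem exists_odd_isCyclicallyReduced (h : ∃ n, Odd n ∧ 0 < cogrowth s n) :
    ∃ u, Odd u.length ∧ FreeGroup.IsCyclicallyReduced u ∧ wordEval s u = 1 := by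
  obtain ⟨n, hn, hpos⟩ := h
  obtain ⟨w, rfl, hw⟩ := (Set.ncard_pos (finite_words n fun w => wordEval s w = 1)).1 hpos
  set v := FreeGroup.reduce w with hv
  have hvw : wordEval s v = 1 := by
    rw [wordEval_eq_lift, hv, FreeGroup.reduce.self, ← wordEval_eq_lift, hw]
  obtain ⟨k, hk⟩ := FreeGroup.Red.length (FreeGroup.reduce.red (L := w))
  have hred : FreeGroup.IsReduced v := FreeGroup.IsReduced.of_reduce_eq FreeGroup.reduce.idem
  have hc := FreeGroup.reduceCyclically.conj_conjugator_reduceCyclically v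
  refine ⟨FreeGroup.reduceCyclically v, ?_,
    FreeGroup.reduceCyclically.isCyclicallyReduced hred, ?_⟩
  · have := congrArg List.length hc
    simp only [List.length_append, FreeGroup.invRev_length] at this
    rw [hk, ← hv, ← this] at hn
    grind
  · rw [← hc, wordEval_append, wordEval_append, wordEval_invRev, mul_inv_eq_one] at hvw
    simpa using hvw

/-- If both failed, the last letter of `w` would be the inverse of the first letter of `u` and equal
to the last letter of `u`, so `u` would cancel cyclically. -/
theorem isReduced_append_or {w u : List (Fin p × Bool)} (hw : FreeGroup.IsReduced w)
    (hu : FreeGroup.IsCyclicallyReduced u) :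
    FreeGroup.IsReduced (w ++ u) ∨ FreeGroup.IsReduced (w ++ FreeGroup.invRev u) := by
  by_contra! h
  obtain ⟨h1, h2⟩ := h
  have hu' : FreeGroup.IsReduced (FreeGroup.invRev u) := by
    apply FreeGroup.IsReduced.of_reduce_eq
    rw [FreeGroup.reduce_invRev, hu.isReduced.reduce_eq]
  have hcyc := (FreeGroup.isCyclicallyReduced_iff.1 hu).2
  rw [FreeGroup.IsReduced, List.isChain_append] at h1 h2
  have h1' : ∃ x ∈ w.getLast?, ∃ y ∈ u.head?, x.1 = y.1 ∧ x.2 ≠ y.2 := by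
    by_contra! hcon
    exact h1 ⟨hw, hu.isReduced, hcon⟩
  have h2' : ∃ x ∈ w.getLast?, ∃ y ∈ (FreeGroup.invRev u).head?, x.1 = y.1 ∧ x.2 ≠ y.2 := by
    by_contra! hcon
    exact h2 ⟨hw, hu', hcon⟩
  obtain ⟨x, hx, y, hy, hxy, hxy'⟩ := h1'
  obtain ⟨x', hx', z, hz, hxz, hxz'⟩ := h2'
  obtain rfl : x' = x := Option.mem_unique hx' hx
  simp only [FreeGroup.invRev, List.head?_reverse, List.getLast?_map, Option.mem_def,
    Option.map_eq_some_iff] at hz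
  obtain ⟨t, ht, rfl⟩ := hz
  have := hcyc t ht y hy (hxz.symm.trans hxy)
  simp only [ne_eq, Bool.eq_not, not_not] at hxz'
  exact hxy' (hxz'.trans this)

theorem cogrowth_le_cogrowth_add {u : List (Fin p × Bool)} (hu : wordEval s u = 1) (n : ℕ) :
    cogrowth s n ≤ cogrowth s (n + u.length) := by
  refine Set.ncard_le_ncard_of_injOn (fun w => w ++ u) ?_ (List.append_left_injective u).injOn
    (finite_words _ _)
  rintro w ⟨hl, hw⟩
  exact ⟨by simp [hl], by rw [wordEval_append, hw, hu, one_mul]⟩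

theorem reducedCogrowth_le_reducedCogrowth_add {u : List (Fin p × Bool)}
    (hu : wordEval s u = 1) (hc : FreeGroup.IsCyclicallyReduced u) (n : ℕ) :
    reducedCogrowth s n ≤ reducedCogrowth s (n + u.length) := by
  classical
  refine Set.ncard_le_ncard_of_injOn
    (fun w => if FreeGroup.IsReduced (w ++ u) then w ++ u else w ++ FreeGroup.invRev u) ?_ ?_
    (finite_words _ _)
  · rintro w ⟨hl, hr, hw⟩
    split_ifs with h
    · exact ⟨by simp [hl], h, by rw [wordEval_append, hw, hu, one_mul]⟩
    · refine ⟨by simp [hl], (isReduced_append_or hr hc).resolve_left h, ?_⟩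
      rw [wordEval_append, wordEval_invRev, hw, hu, one_mul, inv_one]
  · rintro v ⟨hv, -⟩ w ⟨hw, -⟩ h
    -- Whichever suffix was chosen, the first `n` letters recover the word.
    have := congrArg (List.take n) h
    dsimp only at this
    split_ifs at this <;>
    · rw [List.take_left' hv, List.take_left' hw] at this
      exact this

end OddWords

/-! ### Identifying exponential growth rates -/

section Growth

/-- The lower bound is only asked frequently, since odd terms may vanish. -/
theorem growthRate_eq {a : ℕ → ℕ} {A B : ℝ} (hA : 0 < A) (hB : 0 < B)
    (hup : ∀ n, (a n : ℝ) ≤ B * A ^ n)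
    (hlow : ∀ r : ℝ, 0 < r → r < 1 → ∃ c : ℝ, 0 < c ∧ ∃ᶠ n in atTop, c * r ^ n * A ^ n ≤ a n) :
    growthRate a = A := by
  have hroot : ∀ c : ℝ, 0 < c → Tendsto (fun n : ℕ => c ^ (1 / (n : ℝ))) atTop (𝓝 1) := by
    intro c hc
    have := tendsto_const_nhds (x := c).rpow tendsto_one_div_atTop_nhds_zero_nat (Or.inl hc.ne')
    simpa using this
  have hmul : ∀ c r : ℝ, 0 < c → 0 < r → ∀ n : ℕ, n ≠ 0 →
      (c * r ^ n) ^ (1 / (n : ℝ)) = c ^ (1 / (n : ℝ)) * r := by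
    intro c r hc hr n hn
    rw [Real.mul_rpow hc.le (by positivity), one_div, Real.pow_rpow_inv_natCast hr.le hn]
  have hle : (fun n : ℕ => (a n : ℝ) ^ (1 / (n : ℝ))) ≤ᶠ[atTop]
      fun n : ℕ => B ^ (1 / (n : ℝ)) * A := by
    filter_upwards [eventually_ne_atTop 0] with n hn
    rw [← hmul B A hB hA n hn]
    exact Real.rpow_le_rpow (Nat.cast_nonneg _) (hup n) (by positivity)
  have hlimB : Tendsto (fun n : ℕ => B ^ (1 / (n : ℝ)) * A) atTop (𝓝 A) := by
    simpa using (hroot B hB).mul_const A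
  have hbdd : IsBoundedUnder (· ≤ ·) atTop fun n : ℕ => (a n : ℝ) ^ (1 / (n : ℝ)) :=
    hlimB.isBoundedUnder_le.mono_le hle
  apply le_antisymm
  · rw [growthRate, ← hlimB.limsup_eq]
    refine limsup_le_limsup hle ?_ hlimB.isBoundedUnder_le
    exact isCoboundedUnder_le_of_le atTop (x := 0) fun n => by positivity
  · refine le_of_forall_lt_imp_le_of_dense fun b hb => ?_
    rcases le_or_gt b 0 with hb0 | hb0
    · refine hb0.trans (le_limsup_of_frequently_le (Frequently.of_forall fun n => ?_) hbdd)
      positivity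
    obtain ⟨r, hr1, hr2⟩ := exists_between ((div_lt_one hA).2 hb)
    have hr0 : 0 < r := (div_pos hb0 hA).trans hr1
    obtain ⟨c, hc, hfreq⟩ := hlow r hr0 hr2
    have hlim : Tendsto (fun n : ℕ => c ^ (1 / (n : ℝ)) * (r * A)) atTop (𝓝 (r * A)) := by
      simpa using (hroot c hc).mul_const (r * A)
    have hev := hlim.eventually_const_lt ((div_lt_iff₀ hA).1 hr1)
    refine le_limsup_of_frequently_le ((hfreq.and_eventually
      (hev.and (eventually_ne_atTop 0))).mono ?_) hbdd
    rintro n ⟨h1, h2, hn⟩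
    refine h2.le.trans ?_
    rw [← hmul c (r * A) hc (by positivity) n hn]
    refine Real.rpow_le_rpow (by positivity) ?_ (by positivity)
    rwa [mul_pow, ← mul_assoc]

end Growth

/-! ### Comparing the normalized sequences -/

section Comparison

variable {G : Type*} [Group G] {p : ℕ} (s : Fin p → G)

/-- The return probabilities of the simple random walk. -/
def normCogrowth (n : ℕ) : ℝ := cogrowth s n / (2 * p) ^ n

/-- The reduced cogrowth, normalized by `(2p - 1) ^ n`. -/
def normReducedCogrowth (n : ℕ) : ℝ := reducedCogrowth s n / (2 * p - 1) ^ n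

theorem moment_one_pointMass : moment (markov s) (pointMass 1) 1 = 1 := by
  classical
  have := moment_regularRep_pointMass (1 : G) 1
  simpa [moment_apply] using this

variable [NeZero p]

theorem normCogrowth_eq_moment (n : ℕ) :
    normCogrowth s n = moment (markov s) (pointMass 1) (X ^ n) :=
  (moment_pow_pointMass s 1 n).symm

theorem normCogrowth_le_of_forall {m n : ℕ}
    (h : ∀ x : ℝ, |x| ≤ 1 → x ^ m ≤ x ^ n) : normCogrowth s m ≤ normCogrowth s n := by
  rw [normCogrowth_eq_moment, normCogrowth_eq_moment]
  exact moment_mono (isSelfAdjoint_markov s) (norm_markov_le s) _ _ _ fun x hx => by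
    simpa using h x hx

theorem normCogrowth_le {k n : ℕ} (h : 2 * k ≤ n) : normCogrowth s n ≤ normCogrowth s (2 * k) := by
  refine normCogrowth_le_of_forall s fun x hx => ?_
  rw [← Even.pow_abs (even_two_mul k) x]
  exact (le_abs_self _).trans (by
    rw [abs_pow]
    exact pow_le_pow_of_le_one (abs_nonneg x) hx h)

theorem normReducedCogrowth_le (hp : 2 ≤ p) (k : ℕ) : normReducedCogrowth s (2 * k) ≤
    2 * normCogrowth s (2 * k) + 2 * (2 * k + 1) * (2 / 3) ^ k := by
  have hp' : (2 : ℝ) ≤ p := by exact_mod_cast hp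
  set q : ℝ := 2 * p - 1 with hq
  have hq3 : 3 ≤ q := by linarith
  have h := moment_mono (isSelfAdjoint_markov s) (norm_markov_le s) (pointMass 1)
    (reducedPoly q (2 * k))
    (q ^ (2 * k) • ((2 : ℝ) • X ^ (2 * k) + (2 * (2 * k + 1) * (2 / 3) ^ k : ℝ) • 1))
    fun x hx => by simpa [mul_add (q ^ (2 * k))] using eval_reducedPoly_le hq3 hx k
  rw [moment_reducedPoly_pointMass, map_smul, map_add, map_smul, map_smul, moment_one_pointMass,
    ← normCogrowth_eq_moment] at h
  simp only [smul_eq_mul, mul_one] at h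
  rw [normReducedCogrowth, ← hq, div_le_iff₀' (by positivity)]
  exact h

theorem normCogrowth_le_normReducedCogrowth_add (hp : 2 ≤ p) {m n : ℕ} (h : 4 * p * m ≤ n) :
    normCogrowth s (2 * n) ≤ normReducedCogrowth s (2 * m) +
      ((4 * (2 * p - 1) / (2 * p) ^ 2 : ℝ) ^ n + 2 * (2 * m + 1) * (2 / 3) ^ m) := by
  have hp' : (2 : ℝ) ≤ p := by exact_mod_cast hp
  set q : ℝ := 2 * p - 1 with hq
  have hq1 : (2 * p : ℝ) = q + 1 := by rw [hq]; ring
  have hq3 : 3 ≤ q := by linarith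
  have h := moment_mono (isSelfAdjoint_markov s) (norm_markov_le s) (pointMass 1)
    (q ^ (2 * m) • X ^ (2 * n))
    (reducedPoly q (2 * m) + (q ^ (2 * m) *
      ((4 * q / (q + 1) ^ 2) ^ n + 2 * (2 * m + 1) * (2 / 3) ^ m)) • 1)
    fun x hx => by
      simpa using pow_le_eval_reducedPoly_add hq3 hx (K := 4 * p)
        (by push_cast; linarith) h
  rw [map_smul, map_add, map_smul, moment_one_pointMass, moment_reducedPoly_pointMass,
    ← normCogrowth_eq_moment] at h
  simp only [smul_eq_mul, mul_one] at h
  have hpos : 0 < q ^ (2 * m) := by positivity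
  rw [normReducedCogrowth, ← hq, hq1]
  refine le_of_mul_le_mul_left ?_ hpos
  rw [mul_add (q ^ (2 * m)), mul_div_cancel₀ _ hpos.ne']
  exact h

variable {s}

/-- In an amenable group the return probabilities dominate exponentially small terms. -/
theorem eventually_le_normCogrowth (hG : IsAmenable G) {a : ℝ} (ha0 : 0 ≤ a) (ha1 : a < 1)
    (B : ℝ) : ∀ᶠ k : ℕ in atTop, B * (2 * k + 1) * a ^ k ≤ normCogrowth s (2 * k) := by
  obtain ⟨b, hab, hb1⟩ := exists_between ha1
  have hb0 : 0 < b := ha0.trans_lt hab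
  obtain ⟨c, hc, hlow⟩ := exists_mul_pow_le_cogrowth s hG (Real.sqrt_nonneg b)
    ((Real.sqrt_lt' one_pos).2 (by simpa using hb1))
  have hab1 : a / b < 1 := (div_lt_one hb0).2 hab
  have h1 := tendsto_self_mul_const_pow_of_lt_one (div_nonneg ha0 hb0.le) hab1
  have h2 := tendsto_pow_atTop_nhds_zero_of_lt_one (div_nonneg ha0 hb0.le) hab1
  have h3 : Tendsto (fun k : ℕ => B * (2 * k + 1) * (a / b) ^ k) atTop (𝓝 0) := by
    have := ((h1.const_mul 2).add h2).const_mul B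
    simp only [mul_zero, add_zero] at this
    refine this.congr fun k => by ring
  filter_upwards [h3.eventually_le_const hc] with k hk
  refine le_trans ?_ (hlow k)
  rw [pow_mul, Real.sq_sqrt hb0.le]
  rw [div_pow, ← mul_div_assoc, div_le_iff₀ (by positivity)] at hk
  exact hk

theorem eventually_normReducedCogrowth_le (hG : IsAmenable G) (hp : 2 ≤ p) :
    ∀ᶠ k : ℕ in atTop, normReducedCogrowth s (2 * k) ≤ 3 * normCogrowth s (2 * k) := by
  filter_upwards [eventually_le_normCogrowth (s := s) hG (a := 2 / 3) (by norm_num) (by norm_num) 2]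
    with k hk
  linarith [normReducedCogrowth_le s hp k]

theorem eventually_normCogrowth_le (hG : IsAmenable G) (hp : 2 ≤ p) (C : ℕ) :
    ∀ᶠ n : ℕ in atTop, ∀ m : ℕ, 4 * p * m ≤ n → n ≤ 4 * p * m + C →
      normCogrowth s (2 * n) ≤ 2 * normReducedCogrowth s (2 * m) := by
  have hp' : (2 : ℝ) ≤ p := by exact_mod_cast hp
  have hK : 4 * p ≠ 0 := by omega
  -- Rewrites the error (2/3)^m as a power of n ≈ 4pm; the factor τ^(-C) pays for rounding. Each of
  -- the two errors then takes at most a quarter of the left side, hence the constant 2.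
  set τ : ℝ := (2 / 3 : ℝ) ^ ((4 * p : ℕ) : ℝ)⁻¹ with hτ
  have hτ0 : 0 < τ := by positivity
  have hτ1 : τ < 1 := Real.rpow_lt_one (by norm_num) (by norm_num) (by positivity)
  have hτK : τ ^ (4 * p) = 2 / 3 := Real.rpow_inv_natCast_pow (by norm_num) hK
  have hσ0 : (0 : ℝ) ≤ 4 * (2 * p - 1) / (2 * p) ^ 2 := div_nonneg (by linarith) (by positivity)
  have hσ1 : (4 * (2 * p - 1) / (2 * p) ^ 2 : ℝ) < 1 := by
    rw [div_lt_one (by positivity)]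
    nlinarith
  filter_upwards [eventually_le_normCogrowth (s := s) hG hσ0 hσ1 4,
    eventually_le_normCogrowth (s := s) hG hτ0.le hτ1 (8 * (τ ^ C)⁻¹)] with n h1 h2 m hm1 hm2
  have h := normCogrowth_le_normReducedCogrowth_add s hp hm1
  have e1 : (4 * (2 * p - 1) / (2 * p) ^ 2 : ℝ) ^ n ≤ normCogrowth s (2 * n) / 4 := by
    have : 0 ≤ (4 * (2 * p - 1) / (2 * p) ^ 2 : ℝ) ^ n := by positivity
    have : 0 ≤ (n : ℝ) * (4 * (2 * p - 1) / (2 * p) ^ 2 : ℝ) ^ n := by positivity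
    linarith
  have hmn : (m : ℝ) ≤ n := by
    have : m ≤ n := (Nat.le_mul_of_pos_left m (by omega)).trans hm1
    exact_mod_cast this
  have e2 : 2 * (2 * m + 1) * (2 / 3 : ℝ) ^ m ≤ normCogrowth s (2 * n) / 4 := by
    have e3 : (2 / 3 : ℝ) ^ m ≤ (τ ^ C)⁻¹ * τ ^ n := by
      rw [← hτK, ← pow_mul, inv_mul_eq_div, le_div_iff₀ (by positivity), ← pow_add]
      exact pow_le_pow_of_le_one hτ0.le hτ1.le hm2
    calc 2 * (2 * m + 1) * (2 / 3 : ℝ) ^ m ≤ 2 * (2 * n + 1) * ((τ ^ C)⁻¹ * τ ^ n) := by gcongr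
      _ ≤ _ := by linarith
  linarith

end Comparison

/-! ### Growth rates and asymptotic equivalence -/

section Main

theorem two_le_of_not_isCyclic {G : Type*} [Group G] (hZ : ¬ IsCyclic G) {p : ℕ} (s : Fin p → G)
    (hs : Subgroup.closure (Set.range s) = ⊤) : 2 ≤ p := by
  by_contra! h
  apply hZ
  rw [isCyclic_iff_exists_zpowers_eq_top]
  interval_cases p
  · exact ⟨1, by rw [← hs]; simp⟩
  · refine ⟨s 0, ?_⟩
    rw [← hs, Set.range_unique, Subgroup.zpowers_eq_closure]
    rfl

variable {G : Type*} [Group G] {p : ℕ} {s : Fin p → G}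

theorem growthRate_cogrowth [NeZero p] (hG : IsAmenable G) :
    growthRate (cogrowth s) = 2 * p := by
  have hp : (0 : ℝ) < 2 * p := by simp [NeZero.pos]
  refine growthRate_eq hp one_pos (fun n => by simpa using cogrowth_le s n) fun r hr0 hr1 => ?_
  obtain ⟨c, hc, h⟩ := exists_mul_pow_le_cogrowth s hG hr0.le hr1
  refine ⟨c, hc, frequently_atTop.2 fun N => ⟨2 * N, by omega, ?_⟩⟩
  exact (le_div_iff₀ (by positivity)).1 (h N)

theorem growthRate_reducedCogrowth (hG : IsAmenable G) (hp : 2 ≤ p) :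
    growthRate (reducedCogrowth s) = 2 * p - 1 := by
  have hp' : (2 : ℝ) ≤ p := by exact_mod_cast hp
  have : NeZero p := ⟨by omega⟩
  have hq : (0 : ℝ) < 2 * p - 1 := by linarith
  refine growthRate_eq (B := 2 * p) hq (by linarith) (fun n => ?_) fun r hr0 hr1 => ?_
  · rcases n with _ | n
    · have := cogrowth_le s 0
      have h0 : (reducedCogrowth s 0 : ℝ) ≤ cogrowth s 0 := by
        exact Nat.cast_le.2 (Set.ncard_le_ncard (fun w hw => ⟨hw.1, hw.2.2⟩) (finite_words 0 _))
      simp only [pow_zero] at this ⊢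
      linarith
    · refine (reducedCogrowth_succ_le s n).trans ?_
      gcongr
      · linarith
      · omega
  · have hK : 4 * p ≠ 0 := by omega
    -- The 4p-th root of r compensates for comparing length 2m with length 4p · 2m.
    obtain ⟨c, hc, h⟩ := exists_mul_pow_le_cogrowth s hG
      (Real.rpow_nonneg hr0.le ((4 * p : ℕ) : ℝ)⁻¹)
      (Real.rpow_lt_one hr0.le hr1 (by positivity))
    refine ⟨c / 2, by positivity, frequently_atTop.2 fun N => ?_⟩
    obtain ⟨M, hM⟩ := eventually_atTop.1 (eventually_normCogrowth_le (s := s) hG hp 0)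
    set m := max N M with hm
    refine ⟨2 * m, by omega, ?_⟩
    have h1 : M ≤ 4 * p * m := (le_max_right N M).trans (Nat.le_mul_of_pos_left m (by omega))
    have h2 := hM _ h1 m le_rfl le_rfl
    have h3 := h (4 * p * m)
    rw [show 2 * (4 * p * m) = 4 * p * (2 * m) by ring, pow_mul,
      Real.rpow_inv_natCast_pow hr0.le hK] at h3
    rw [show 2 * (4 * p * m) = 4 * p * (2 * m) by ring] at h2
    have h4 : c / 2 * r ^ (2 * m) ≤ normReducedCogrowth s (2 * m) := by
      have : c * r ^ (2 * m) ≤ normCogrowth s (4 * p * (2 * m)) := h3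
      linarith
    exact (le_div_iff₀ (by positivity)).1 h4

theorem asympLE_of_eventually_le {f g : ℕ → ℝ} {a : ℝ} (ha : 0 < a)
    (h : ∀ᶠ n in atTop, f n ≤ a * g n) : AsympLE f g :=
  ⟨a, 1, ha, one_pos, by simpa using h⟩

theorem asympLE_of_eventually_le_div {f g : ℕ → ℝ} {a : ℝ} (ha : 0 < a) {K : ℕ} (hK : 0 < K)
    (h : ∀ᶠ n in atTop, f n ≤ a * g (n / K)) : AsympLE f g := by
  refine ⟨a, (K : ℝ)⁻¹, ha, by positivity, h.mono fun n hn => ?_⟩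
  rwa [inv_mul_eq_div, Nat.floor_div_eq_div]

theorem asympEquiv_even (hG : IsAmenable G) (hp : 2 ≤ p) :
    AsympEquiv (fun k => normCogrowth s (2 * k)) (fun k => normReducedCogrowth s (2 * k)) := by
  have : NeZero p := ⟨by omega⟩
  refine ⟨asympLE_of_eventually_le_div two_pos (K := 4 * p) (by omega) ?_,
    asympLE_of_eventually_le three_pos (eventually_normReducedCogrowth_le hG hp)⟩
  filter_upwards [eventually_normCogrowth_le (s := s) hG hp (4 * p)] with n hn
  exact hn _ (Nat.mul_div_le n _) (Nat.lt_mul_div_succ n (by omega : 0 < 4 * p)).le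

theorem normCogrowth_le_mul_normCogrowth_add {u : List (Fin p × Bool)} (hu : wordEval s u = 1)
    (n : ℕ) : normCogrowth s n ≤ (2 * p) ^ u.length * normCogrowth s (n + u.length) := by
  rcases Nat.eq_zero_or_pos p with rfl | hp
  · have hu0 : u = [] := by
      cases u with
      | nil => rfl
      | cons a _ => exact a.1.elim0
    simp [hu0]
  have h : (cogrowth s n : ℝ) ≤ cogrowth s (n + u.length) := by
    exact_mod_cast cogrowth_le_cogrowth_add s hu n
  rw [normCogrowth, normCogrowth, pow_add, div_le_iff₀ (by positivity)]
  field_simp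
  exact h

theorem normReducedCogrowth_le_mul_normReducedCogrowth_add (hp : 2 ≤ p)
    {u : List (Fin p × Bool)} (hu : wordEval s u = 1) (hc : FreeGroup.IsCyclicallyReduced u)
    (n : ℕ) : normReducedCogrowth s n ≤
      (2 * p - 1) ^ u.length * normReducedCogrowth s (n + u.length) := by
  have hp' : (2 : ℝ) ≤ p := by exact_mod_cast hp
  have hq : (0 : ℝ) < 2 * p - 1 := by linarith
  have h : (reducedCogrowth s n : ℝ) ≤ reducedCogrowth s (n + u.length) := by
    exact_mod_cast reducedCogrowth_le_reducedCogrowth_add s hu hc n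
  rw [normReducedCogrowth, normReducedCogrowth, pow_add, div_le_iff₀ (by positivity)]
  field_simp
  exact h

theorem normReducedCogrowth_nonneg (hp : 2 ≤ p) (n : ℕ) : 0 ≤ normReducedCogrowth s n := by
  have hp' : (2 : ℝ) ≤ p := by exact_mod_cast hp
  have hq : (0 : ℝ) < 2 * p - 1 := by linarith
  exact div_nonneg (Nat.cast_nonneg _) (by positivity)

theorem normCogrowth_nonneg (n : ℕ) : 0 ≤ normCogrowth s n :=
  div_nonneg (Nat.cast_nonneg _) (by positivity)

theorem asympLE_normCogrowth_of_odd (hG : IsAmenable G) (hp : 2 ≤ p)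
    {u : List (Fin p × Bool)} (hodd : Odd u.length) (hu : wordEval s u = 1)
    (hc : FreeGroup.IsCyclicallyReduced u) :
    AsympLE (normCogrowth s) (normReducedCogrowth s) := by
  have : NeZero p := ⟨by omega⟩
  have hp' : (2 : ℝ) ≤ p := by exact_mod_cast hp
  have hq : (1 : ℝ) ≤ 2 * p - 1 := by linarith
  set l := u.length with hl
  set Q : ℝ := (2 * p - 1) ^ l with hQ
  have hQ1 : 1 ≤ Q := one_le_pow₀ hq
  refine asympLE_of_eventually_le_div (a := 2 * Q) (by positivity) (K := 4 * p) (by omega) ?_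
  obtain ⟨N, hN⟩ :=
    eventually_atTop.1 (eventually_normCogrowth_le (s := s) hG hp (4 * p * (l + 1)))
  filter_upwards [eventually_ge_atTop (2 * N + 1), eventually_ge_atTop (4 * p * l)] with n hn1 hn2
  have hlm : l ≤ n / (4 * p) := by
    rw [Nat.le_div_iff_mul_le (by omega)]
    linarith
  have hm1 : 4 * p * (n / (4 * p)) ≤ n := Nat.mul_div_le n _
  have hm2 : n < 4 * p * (n / (4 * p) + 1) := Nat.lt_mul_div_succ n (by omega)
  set m := n / (4 * p) with hm
  -- Pass to the even length 2⌊n/2⌋ and compare with an even 2m'. It will be m or m - l, according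
  -- to the parity of m; in the odd case `u` leads back to m.
  have key : ∀ m', 2 * m' ≤ m → m ≤ 2 * m' + l →
      normCogrowth s n ≤ 2 * normReducedCogrowth s (2 * m') := by
    intro m' h1 h2
    have hle := normCogrowth_le s (Nat.mul_div_le n 2)
    refine hle.trans (hN (n / 2) (by omega) m' ?_ ?_)
    · have := Nat.mul_le_mul_left (4 * p) h1
      rw [Nat.le_div_iff_mul_le two_pos]
      linarith
    · have := Nat.mul_le_mul_left (4 * p) (Nat.succ_le_succ h2)
      have h3 : n ≤ 2 * (4 * p * m' + 4 * p * (l + 1)) := by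
        simp only [Nat.succ_eq_add_one] at this
        nlinarith
      omega
  rcases Nat.even_or_odd m with he | ho
  · obtain ⟨m', hm'⟩ := he.exists_two_nsmul
    rw [smul_eq_mul] at hm'
    have h := key m' hm'.ge (by omega)
    rw [← hm'] at h
    nlinarith [normReducedCogrowth_nonneg (s := s) hp m]
  · obtain ⟨m', hm'⟩ := (Nat.Odd.sub_odd ho hodd).exists_two_nsmul
    rw [smul_eq_mul] at hm'
    have h := key m' (by omega) (by omega)
    have h2 := normReducedCogrowth_le_mul_normReducedCogrowth_add hp hu hc (2 * m')
    rw [← hm', Nat.sub_add_cancel hlm] at h2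
    rw [← hm'] at h
    linarith

theorem asympLE_normReducedCogrowth_of_odd (hG : IsAmenable G) (hp : 2 ≤ p)
    {u : List (Fin p × Bool)} (hodd : Odd u.length) (hu : wordEval s u = 1)
    (hc : FreeGroup.IsCyclicallyReduced u) :
    AsympLE (normReducedCogrowth s) (normCogrowth s) := by
  have : NeZero p := ⟨by omega⟩
  have hp' : (2 : ℝ) ≤ p := by exact_mod_cast hp
  set l := u.length with hl
  set Q : ℝ := (2 * p - 1) ^ l with hQ
  set D : ℝ := (2 * p) ^ l with hD
  have hQ1 : 1 ≤ Q := one_le_pow₀ (by linarith)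
  have hD1 : 1 ≤ D := one_le_pow₀ (by linarith)
  refine asympLE_of_eventually_le (a := 3 * (Q * D)) (by positivity) ?_
  obtain ⟨N, hN⟩ := eventually_atTop.1 (eventually_normReducedCogrowth_le (s := s) hG hp)
  filter_upwards [eventually_ge_atTop (2 * N), eventually_ge_atTop l] with n hn1 hn2
  rcases Nat.even_or_odd n with he | ho
  · obtain ⟨k, hk⟩ := he.exists_two_nsmul
    rw [smul_eq_mul] at hk
    have h := hN k (by omega)
    rw [← hk] at h
    have h1 : 1 ≤ Q * D := one_le_mul_of_one_le_of_one_le hQ1 hD1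
    nlinarith [normCogrowth_nonneg (s := s) n]
  · obtain ⟨k, hk⟩ := (Nat.Odd.sub_odd ho hodd).exists_two_nsmul
    rw [smul_eq_mul] at hk
    -- For odd n the chain of lengths is n → n + l = 2(k + l) by appending `u` or its inverse, then
    -- 2k by monotonicity along even lengths, then back to n = 2k + l by appending `u`.
    have hkn : n = 2 * k + l := by omega
    have h1 := normReducedCogrowth_le_mul_normReducedCogrowth_add hp hu hc n
    have h2 := hN (k + l) (by omega)
    have h3 := normCogrowth_le s (k := k) (n := 2 * (k + l)) (by omega)
    have h4 := normCogrowth_le_mul_normCogrowth_add hu (2 * k)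
    rw [← hl, ← hkn] at h4
    rw [← hl, show n + l = 2 * (k + l) by omega] at h1
    calc normReducedCogrowth s n ≤ Q * normReducedCogrowth s (2 * (k + l)) := h1
      _ ≤ Q * (3 * (D * normCogrowth s n)) := by gcongr; linarith
      _ = _ := by ring

end Main

end Cogrowth
end

theorem mainTheorem2 {G : Type*} [Group G] [Infinite G] (hG : Cogrowth.IsAmenable G)
    (hZ : ¬ IsCyclic G) (p : ℕ) (s : Fin p → G) (hs : Subgroup.closure (Set.range s) = ⊤) :
    Cogrowth.growthRate (Cogrowth.cogrowth s) = 2 * (p : ℝ) ∧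
    Cogrowth.growthRate (Cogrowth.reducedCogrowth s) = 2 * (p : ℝ) - 1 ∧
    Cogrowth.AsympEquiv (fun k => Cogrowth.subdominant (Cogrowth.cogrowth s) (2 * k))
      (fun k => Cogrowth.subdominant (Cogrowth.reducedCogrowth s) (2 * k)) ∧
    ((∃ n, Odd n ∧ 0 < Cogrowth.cogrowth s n) →
      Cogrowth.AsympEquiv (Cogrowth.subdominant (Cogrowth.cogrowth s))
        (Cogrowth.subdominant (Cogrowth.reducedCogrowth s))) := by
  have hp := Cogrowth.two_le_of_not_isCyclic hZ s hs
  have : NeZero p := ⟨by omega⟩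
  have hd := Cogrowth.growthRate_cogrowth (s := s) hG
  have hc := Cogrowth.growthRate_reducedCogrowth (s := s) hG hp
  have hd' : Cogrowth.subdominant (Cogrowth.cogrowth s) = Cogrowth.normCogrowth s := by
    ext n
    rw [Cogrowth.subdominant, hd, Cogrowth.normCogrowth]
  have hc' : Cogrowth.subdominant (Cogrowth.reducedCogrowth s) =
      Cogrowth.normReducedCogrowth s := by
    ext n
    rw [Cogrowth.subdominant, hc, Cogrowth.normReducedCogrowth]
  rw [hd', hc']
  refine ⟨hd, hc, Cogrowth.asympEquiv_even hG hp, fun hodd => ?_⟩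
  obtain ⟨u, hl, hcyc, hu⟩ := Cogrowth.exists_odd_isCyclicallyReduced s hodd
  exact ⟨Cogrowth.asympLE_normCogrowth_of_odd hG hp hl hu hcyc,
    Cogrowth.asympLE_normReducedCogrowth_of_odd hG hp hl hu hcyc⟩
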